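/- Let $n\ge 1$ be an integer and write $[n]_x=1+x+\cdots+x^{n-1}$. Let $\Phi_n$ be the $q$-deformed metallic number, i.e. the value, in the field of formal Laurent series $\mathbb{Q}(\!(q)\!)$ with its $q$-adic topology, of the 2-periodic continued fraction $$\Phi_n(q)=[n]_q+\cfrac{q^{n}}{[n]_{q^{-1}}+\cfrac{q^{-n}}{[n]_q+\cfrac{q^{n}}{[n]_{q^{-1}}+\cfrac{q^{-n}}{[n]_q+\ddots}}}}\,.$$ The convergents of this continued fraction converge, and the limit is a power series $\Phi_n=\sum_{i\ge 0}f_iq^i$ with integer coefficients. For $\ell,j\ge 0$ let $\Delta^{(\ell)}_j=\det\bigl(f_{\ell+a+b}\bigr)_{0\le a,b\le j-1}$ be its shifted Hankel determinants (with $\Delta^{(\ell)}_0=1$). Then: 1. For all $\ell\in\{0,1,\ldots,n\}$ and all $j\ge 0$, $$\Delta^{(\ell+1)}_j=(-1)^{\,j+\frac{n(n+2\ell-1)}{2}}\,\Delta^{(\ell)}_{j+n+1}.$$ 2. Consequently every shifted sequence $\Delta^{(\ell)}$ with $0\le\ell\le n+1$ is determined by the unshifted sequence $\Delta^{(0)}$: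 for all $\ell\in\{0,1,\ldots,n+1\}$ and all $j\ge 0$, $$\Delta^{(\ell)}_j=(-1)^{\,\ell j+\frac{\ell(\ell-1)}{2}+\ell\,\frac{n(n-1)}{2}}\,\Delta^{(0)}_{j+\ell(n+1)}.$$ -/

import Mathlib

open Filter Topology
open scoped LaurentSeries PowerSeries

noncomputable section

namespace QMetallic

/-- The Euler-Gauss `q`-integer `[m]_x = 1 + x + ⋯ + x ^ (m - 1)`, with parameter `x`. -/
def qInt {K : Type*} [Semiring K] (x : K) (m : ℕ) : K :=
  ∑ i ∈ Finset.range m, x ^ i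

/-- The indeterminate `q` of the field `ℚ((q))` of formal Laurent series. -/
def q : ℚ⸨X⸩ := HahnSeries.single 1 1

/-- The 2-periodic continued fraction
`[n]_q + q^n / ([n]_{q⁻¹} + q^{-n} / ([n]_q + q^n / ([n]_{q⁻¹} + q^{-n} / ([n]_q + ⋯))))`
over `ℚ((q))`; a pair `⟨a, b⟩` stands for the partial numerator `a` and
the partial denominator `b`. -/
def metallicFraction (n : ℕ) : GenContFract ℚ⸨X⸩ where
  h := qInt q n
  s := Stream'.Seq.ofStream fun i : ℕ =>
    if Even i then ⟨q ^ (n : ℤ), qInt q⁻¹ n⟩ else ⟨q ^ (-(n : ℤ)), qInt q n⟩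

/-- The power series `Φ` with integer coefficients is the `q`-metallic number `Φ_n`, that is,
the value of the continued fraction `metallicFraction n`: its convergents tend to `Φ` in `ℚ((q))`
(with the `q`-adic topology, which is the one Mathlib puts on Laurent series over a field). -/
def IsQMetallic (n : ℕ) (Φ : ℤ⟦X⟧) : Prop :=
  Tendsto (fun k : ℕ => (metallicFraction n).convs k) atTop
    (𝓝 (HahnSeries.ofPowerSeries ℤ ℚ (Φ.map (Int.castRingHom ℚ))))

/-- The Hankel determinant `Δ_j^{(ℓ)}(F) = det (f_{ℓ + a + b})_{0 ≤ a, b < j}` of size `j` and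
shift `ℓ` of a power series `F = ∑ f_i X^i`. -/
def hankelDet {R : Type*} [CommRing R] (F : R⟦X⟧) (ℓ j : ℕ) : R :=
  (Matrix.of fun a b : Fin j => PowerSeries.coeff (ℓ + a + b) F).det

end QMetallic

end

/-!
The metallic number satisfies `Φ = [n] + X ^ (2 n) w` with `w⁻¹ = (1 - X) (1 + X ^ n) + X Φ`
(`MetallicPair`), an equation that a contraction argument solves over `ℤ[[X]]`. The complete
quotients of the continued fraction are then `Φ` and `q ^ (-n) / w` alternately, so the error of a
convergent times its denominator is a product of powers of `q ^ (2 n) w` and `Φ⁻¹`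
(`scaled_error`), while the denominators, suitably scaled, are power series with constant
term `1` (`scaled_dens`). Hence the convergents tend to `Φ`.

For the Hankel determinants the tool is `hankelDet_step`: if `F = X ^ d / (u + X ^ (d + 2) G)` with
`u` a polynomial of degree at most `d + 1` and constant term `1`, multiplying the Hankel matrix of
`F` by the unitriangular Toeplitz matrix of the denominator and by its transpose makes it block
diagonal, with an antitriangular block of size `d + 1` and minus the Hankel matrix of `G`.

Write `Φ_ℓ` for `Φ` with its first `ℓ` coefficients removed, shifted to start in degree `0`, and
let `k = n - ℓ`. Then `Φ_ℓ = [k] + X ^ (n + k) w`, and `w⁻¹` is an expression in `Φ_{ℓ+1}` because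
`X Φ = X [ℓ + 1] + X ^ (ℓ + 2) Φ_{ℓ+1}` for `ℓ < n`. For `k ≥ 2` this unfolds to
`Φ_ℓ = 1 / (1 - X + X ^ 2 G₁)`, `G₁ = X ^ (k - 2) / ([k] + X ^ k G₂)`,
`G₂ = X ^ ℓ / (1 + X ^ 2 [ℓ] + X ^ (ℓ + 2) Φ_{ℓ+1})`,
three steps which together remove `1 + (k - 1) + (ℓ + 1) = n + 1` rows; for `k = 1` and `k = 0` two
steps and one step do the same. Collecting the signs gives the relation between the shifts `ℓ` and
`ℓ + 1`, and iterating it gives the relation with the unshifted determinants.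
-/

namespace QMetallic

/-! ### Hankel determinants under one continued fraction step -/

section Hankel

variable {R : Type*} [CommRing R]

theorem det_of_antitriangular (m : ℕ) (A : Matrix (Fin m) (Fin m) R)
    (h0 : ∀ a b : Fin m, (a : ℕ) + b + 1 < m → A a b = 0)
    (h1 : ∀ a b : Fin m, (a : ℕ) + b + 1 = m → A a b = 1) :
    A.det = (-1) ^ (m * (m - 1) / 2) := by
  induction m with
  | zero => simp
  | succ m ih =>
    rw [Matrix.det_succ_row_zero, Fin.sum_univ_castSucc, Finset.sum_eq_zero, zero_add,
      h1 0 (Fin.last m) (by simp), ih]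
    · rw [mul_one, ← pow_add, Fin.val_last, Nat.triangle_succ, add_comm]
    · intro a b hab
      exact h0 _ _ (by simp [Fin.succAbove_last]; omega)
    · intro a b hab
      exact h1 _ _ (by simp [Fin.succAbove_last]; omega)
    · intro b _
      rw [h0 0 b.castSucc (by simp)]
      simp

/-- The entry `(a, b)` of `L H Lᵀ`, where `H` is the Hankel matrix of `F` and `L` is the lower
triangular Toeplitz matrix of `V`. -/
noncomputable def toeplitzConj (V F : R⟦X⟧) (a b : ℕ) : R :=
  ∑ c ∈ Finset.range (a + 1), PowerSeries.coeff (a - c) V *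
    ∑ e ∈ Finset.range (b + 1), PowerSeries.coeff (b - e) V * PowerSeries.coeff (c + e) F

theorem sum_range_coeff_mul_coeff (V F : R⟦X⟧) (a : ℕ) :
    ∑ c ∈ Finset.range (a + 1), PowerSeries.coeff (a - c) V * PowerSeries.coeff c F =
      PowerSeries.coeff a (F * V) := by
  rw [PowerSeries.coeff_mul, Finset.Nat.sum_antidiagonal_eq_sum_range_succ_mk]
  exact Finset.sum_congr rfl fun c _ => mul_comm _ _

/-- Moving one step along an antidiagonal. With generating functions this is the identity
`(x F(x) - y F(y)) V(x) V(y) = x (F V)(x) V(y) - y (F V)(y) V(x)`. -/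
theorem toeplitzConj_succ (V F : R⟦X⟧) (a b : ℕ) :
    toeplitzConj V F a (b + 1) = toeplitzConj V F (a + 1) b +
      PowerSeries.coeff (b + 1) V * PowerSeries.coeff a (F * V) -
      PowerSeries.coeff (a + 1) V * PowerSeries.coeff b (F * V) := by
  have h1 : toeplitzConj V F a (b + 1) =
      PowerSeries.coeff (b + 1) V * PowerSeries.coeff a (F * V) +
      ∑ c ∈ Finset.range (a + 1), PowerSeries.coeff (a - c) V *
        ∑ e ∈ Finset.range (b + 1),
          PowerSeries.coeff (b - e) V * PowerSeries.coeff (c + 1 + e) F := by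
    rw [toeplitzConj, ← sum_range_coeff_mul_coeff, Finset.mul_sum, ← Finset.sum_add_distrib]
    refine Finset.sum_congr rfl fun c _ => ?_
    rw [Finset.sum_range_succ' _ (b + 1)]
    have : ∀ e, c + 1 + e = c + (e + 1) := fun e => by ring
    simp only [Nat.add_sub_add_right, this, Nat.sub_zero, add_zero]
    ring
  have h2 : toeplitzConj V F (a + 1) b =
      PowerSeries.coeff (a + 1) V * PowerSeries.coeff b (F * V) +
      ∑ c ∈ Finset.range (a + 1), PowerSeries.coeff (a - c) V *
        ∑ e ∈ Finset.range (b + 1),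
          PowerSeries.coeff (b - e) V * PowerSeries.coeff (c + 1 + e) F := by
    rw [toeplitzConj, ← sum_range_coeff_mul_coeff, Finset.sum_range_succ' _ (a + 1)]
    simp only [Nat.add_sub_add_right, Nat.sub_zero, zero_add]
    ring
  rw [h1, h2]
  ring

/-- If `F V = X ^ d`, then the matrix `L H Lᵀ` is block diagonal: an antitriangular block of size
`d + 1`, and minus the Hankel matrix of the coefficients of `V` from `X ^ (d + 2)` on. -/
theorem toeplitzConj_eq {V F : R⟦X⟧} {d : ℕ} (hV : PowerSeries.coeff 0 V = 1)
    (hFV : F * V = PowerSeries.X ^ d) (a b : ℕ) :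
    toeplitzConj V F a b =
      if a ≤ d ∧ b ≤ d then (if d ≤ a + b then PowerSeries.coeff (a + b - d) V else 0)
      else if d < a ∧ d < b then -PowerSeries.coeff (a + b - d) V else 0 := by
  induction b generalizing a with
  | zero =>
    have : toeplitzConj V F a 0 = PowerSeries.coeff a (F * V) := by
      rw [← sum_range_coeff_mul_coeff, toeplitzConj]
      rw [zero_add, Finset.sum_congr rfl]
      intro c _
      rw [Finset.sum_range_one, Nat.sub_zero, hV, one_mul, add_zero]
    rw [this, hFV, PowerSeries.coeff_X_pow]
    rcases lt_trichotomy a d with h | h | h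
    · simp [h.ne, h.not_ge]
    · simp [h, hV]
    · simp [h.ne', h.not_ge]
  | succ b ih =>
    rw [toeplitzConj_succ, ih, hFV, PowerSeries.coeff_X_pow, PowerSeries.coeff_X_pow]
    have e : a + 1 + b = a + (b + 1) := by ring
    rw [e]
    rcases lt_trichotomy a d with ha | ha | ha <;> rcases lt_trichotomy b d with hb | hb | hb
    · simp [ha.ne, hb.ne, show a + 1 ≤ d by omega, show b ≤ d by omega, show b + 1 ≤ d by omega,
        ha.le]
    · subst hb
      simp [ha.ne, show a + 1 ≤ b by omega, ha.not_gt, show b ≤ a + (b + 1) by omega,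
        show a + (b + 1) - b = a + 1 by omega]
    · simp [ha.ne, hb.ne', hb.not_ge, ha.not_gt, show ¬ b + 1 ≤ d by omega,
        show ¬ d < a + 1 by omega]
    · subst ha
      simp [hb.ne, hb.not_gt, show b + 1 ≤ a by omega, show a + (b + 1) - a = b + 1 by omega]
    · subst ha hb
      simp
    · subst ha
      simp [hb.ne', hb.not_ge, hb, show ¬ b + 1 ≤ a by omega,
        show a + (b + 1) - a = b + 1 by omega]
    · simp [ha.ne', ha.not_ge, hb.ne, hb.not_gt, show ¬ d ≤ b  by omega,
        show ¬ a + 1 ≤ d by omega]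
    · subst hb
      simp [ha.ne', ha.not_ge, ha, show a + (b + 1) - b = a + 1 by omega,
        show ¬ a + 1 ≤ b by omega]
    · simp [ha.ne', hb.ne', ha.not_ge, ha, hb, show ¬ a + 1 ≤ d by omega,
        show d < a + 1 by omega, show d < b + 1 by omega]

/-- One step of a continued fraction expansion: if `F = X ^ d / (u + X ^ (d + 2) G)` with a
polynomial `u` of degree at most `d + 1` and constant term `1`, then the Hankel determinants of
`F` are, up to sign, those of `G` with the size shifted by `d + 1`. -/
theorem hankelDet_step {F G u : R⟦X⟧} {d : ℕ} (h0 : PowerSeries.coeff 0 u = 1)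
    (hu : ∀ i, d + 1 < i → PowerSeries.coeff i u = 0)
    (hF : F * (u + PowerSeries.X ^ (d + 2) * G) = PowerSeries.X ^ d) (j : ℕ) :
    hankelDet F 0 (d + 1 + j) = (-1) ^ (d * (d + 1) / 2 + j) * hankelDet G 0 j := by
  set V := u + PowerSeries.X ^ (d + 2) * G with hVdef
  have hV : PowerSeries.coeff 0 V = 1 := by
    rw [hVdef, map_add, h0, PowerSeries.coeff_X_pow_mul', if_neg (by omega), add_zero]
  have hVG : ∀ i, PowerSeries.coeff (d + 2 + i) V = PowerSeries.coeff i G := fun i => by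
    rw [hVdef, map_add, hu _ (by omega), zero_add, add_comm (d + 2), PowerSeries.coeff_X_pow_mul]
  obtain ⟨L, hL⟩ : ∃ L : Matrix (Fin (d + 1 + j)) (Fin (d + 1 + j)) R, ∀ a c, L a c =
    if (c : ℕ) ≤ a then PowerSeries.coeff ((a : ℕ) - c) V else 0 := ⟨fun a c => _, fun _ _ => rfl⟩
  have hLdet : L.det = 1 := by
    rw [Matrix.det_of_isLowerTriangular]
    · simp_rw [hL, Nat.sub_self, hV, le_refl, if_true, Finset.prod_const_one]
    · intro a b hab
      have : (a : ℕ) < b := hab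
      rw [hL, if_neg (by omega)]
  set H : Matrix (Fin (d + 1 + j)) (Fin (d + 1 + j)) R :=
    Matrix.of fun a b => PowerSeries.coeff (0 + a + b) F with hH
  -- sums over `Fin` against a row of `L` are sums over an initial segment of `ℕ`
  have key : ∀ (a : Fin (d + 1 + j)) (g : ℕ → R), ∑ c : Fin (d + 1 + j), L a c * g c =
      ∑ c ∈ Finset.range ((a : ℕ) + 1), PowerSeries.coeff ((a : ℕ) - c) V * g c := by
    intro a g
    simp_rw [hL]
    rw [Fin.sum_univ_eq_sum_range
      (fun c => (if c ≤ (a : ℕ) then PowerSeries.coeff ((a : ℕ) - c) V else 0) * g c)]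
    have hsub : Finset.range ((a : ℕ) + 1) ⊆ Finset.range (d + 1 + j) :=
      Finset.range_subset_range.2 a.2
    rw [← Finset.sum_subset hsub]
    · refine Finset.sum_congr rfl fun c hc => ?_
      rw [if_pos (by simpa [Nat.lt_succ_iff] using hc)]
    · intro c _ hc
      rw [if_neg (by simpa [Nat.lt_succ_iff] using hc), zero_mul]
  have hconj : ∀ a b, (L * (H * L.transpose)) a b = toeplitzConj V F a b := by
    intro a b
    rw [Matrix.mul_apply, toeplitzConj, ← key a fun c => ∑ e ∈ Finset.range ((b : ℕ) + 1),
      PowerSeries.coeff ((b : ℕ) - e) V * PowerSeries.coeff (c + e) F]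
    refine Finset.sum_congr rfl fun c _ => ?_
    rw [Matrix.mul_apply, ← key b fun e => PowerSeries.coeff ((c : ℕ) + e) F]
    congr 1
    refine Finset.sum_congr rfl fun e _ => ?_
    rw [Matrix.transpose_apply, hH, Matrix.of_apply, zero_add, mul_comm]
  have hdet : hankelDet F 0 (d + 1 + j) = (L * (H * L.transpose)).det := by
    rw [Matrix.det_mul, Matrix.det_mul, Matrix.det_transpose, hLdet, one_mul, mul_one, hH,
      hankelDet]
  rw [hdet, ← Matrix.det_submatrix_equiv_self finSumFinEquiv,
    ← Matrix.fromBlocks_toBlocks ((L * (H * L.transpose)).submatrix _ _)]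
  have h21 : ((L * (H * L.transpose)).submatrix (finSumFinEquiv (m := d + 1) (n := j))
      finSumFinEquiv).toBlocks₂₁ = 0 := by
    ext a b
    rw [Matrix.toBlocks₂₁, Matrix.of_apply, Matrix.submatrix_apply, hconj,
      finSumFinEquiv_apply_left, finSumFinEquiv_apply_right, Fin.val_natAdd, Fin.val_castAdd,
      toeplitzConj_eq hV hF, if_neg (by omega), if_neg (by omega), Matrix.zero_apply]
  rw [h21, Matrix.det_fromBlocks_zero₂₁, det_of_antitriangular (d + 1), pow_add]
  · have h22 : ((L * (H * L.transpose)).submatrix (finSumFinEquiv (m := d + 1) (n := j))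
        finSumFinEquiv).toBlocks₂₂ =
        -Matrix.of fun a b : Fin j => PowerSeries.coeff (0 + a + b) G := by
      ext a b
      rw [Matrix.toBlocks₂₂, Matrix.of_apply, Matrix.submatrix_apply, hconj,
        finSumFinEquiv_apply_right, finSumFinEquiv_apply_right, Fin.val_natAdd, Fin.val_natAdd,
        toeplitzConj_eq hV hF, Matrix.neg_apply, Matrix.of_apply, ← hVG, if_neg (by omega),
        if_pos (by omega)]
      congr 3
      omega
    rw [h22, Matrix.det_neg, Fintype.card_fin, hankelDet, Nat.add_sub_cancel, mul_comm (d + 1),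
      mul_assoc]
  · intro a b hab
    rw [Matrix.toBlocks₁₁, Matrix.of_apply, Matrix.submatrix_apply, hconj,
      finSumFinEquiv_apply_left, finSumFinEquiv_apply_left, Fin.val_castAdd, Fin.val_castAdd,
      toeplitzConj_eq hV hF, if_pos (by omega), if_neg (by omega)]
  · intro a b hab
    rw [Matrix.toBlocks₁₁, Matrix.of_apply, Matrix.submatrix_apply, hconj,
      finSumFinEquiv_apply_left, finSumFinEquiv_apply_left, Fin.val_castAdd, Fin.val_castAdd,
      toeplitzConj_eq hV hF, if_pos (by omega), if_pos (by omega),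
      show (a : ℕ) + b - d = 0 by omega, hV]

theorem hankelDet_neg (F : R⟦X⟧) (ℓ j : ℕ) :
    hankelDet (-F) ℓ j = (-1) ^ j * hankelDet F ℓ j := by
  have : (Matrix.of fun a b : Fin j => PowerSeries.coeff (ℓ + a + b) (-F)) =
      -Matrix.of fun a b : Fin j => PowerSeries.coeff (ℓ + a + b) F := by
    ext a b
    simp
  rw [hankelDet, this, Matrix.det_neg, Fintype.card_fin, hankelDet]

/-- Splitting off a polynomial of degree less than `ℓ` turns the shift `ℓ` into no shift. -/
theorem hankelDet_add_X_pow_mul {p F : R⟦X⟧} {ℓ : ℕ}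
    (hp : ∀ i, ℓ ≤ i → PowerSeries.coeff i p = 0) (j : ℕ) :
    hankelDet (p + PowerSeries.X ^ ℓ * F) ℓ j = hankelDet F 0 j := by
  rw [hankelDet, hankelDet]
  congr 1
  ext a b
  rw [Matrix.of_apply, Matrix.of_apply, map_add, hp _ (by omega), zero_add,
    PowerSeries.coeff_X_pow_mul', if_pos (by omega)]
  congr 2
  omega

end Hankel

/-! ### The quadratic equation of the metallic number -/

section QInt

theorem map_qInt {K L : Type*} [Semiring K] [Semiring L] (f : K →+* L) (x : K) (m : ℕ) :
    f (qInt x m) = qInt (f x) m := by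
  simp [qInt]

theorem qInt_add {K : Type*} [CommRing K] (x : K) (a b : ℕ) :
    qInt x (a + b) = qInt x a + x ^ a * qInt x b := by
  rw [qInt, Finset.sum_range_add, qInt, qInt, Finset.mul_sum]
  simp_rw [pow_add]

theorem qInt_succ {K : Type*} [CommRing K] (x : K) (m : ℕ) :
    qInt x (m + 1) = 1 + x * qInt x m := by
  rw [add_comm, qInt_add, pow_one]
  simp [qInt]

theorem one_sub_mul_qInt {K : Type*} [CommRing K] (x : K) (m : ℕ) :
    (1 - x) * qInt x m = 1 - x ^ m :=
  mul_neg_geom_sum x m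

theorem coeff_qInt_X {R : Type*} [CommRing R] (m i : ℕ) :
    PowerSeries.coeff i (qInt (PowerSeries.X : R⟦X⟧) m) = if i < m then 1 else 0 := by
  simp [qInt, PowerSeries.coeff_X_pow]

end QInt

section Quadratic

variable {R : Type*} [CommRing R]

open PowerSeries in
/-- A quadratic equation `w = 1 + X (A w + B w ^ 2)` over power series has a solution, because its
right-hand side is a contraction in the `X`-adic topology. -/
theorem exists_eq_one_add_X_mul (A B : R⟦X⟧) : ∃ w : R⟦X⟧, w = 1 + X * (A * w + B * w ^ 2) := by
  let T : R⟦X⟧ → R⟦X⟧ := fun w => 1 + X * (A * w + B * w ^ 2)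
  have hT : ∀ (k : ℕ) (v w : R⟦X⟧), X ^ k ∣ v - w → X ^ (k + 1) ∣ T v - T w := by
    rintro k v w ⟨c, hc⟩
    exact ⟨c * (A + B * (v + w)), by
      simp only [T, pow_succ]; linear_combination X * (A + B * (v + w)) * hc⟩
  let s : ℕ → R⟦X⟧ := fun k => T^[k] 0
  have hs : ∀ k, s (k + 1) = T (s k) := fun k => Function.iterate_succ_apply' T k 0
  have hstep : ∀ k, X ^ k ∣ s (k + 1) - s k := by
    intro k
    induction k with
    | zero => simp
    | succ k ih => rw [hs (k + 1), hs k]; simpa only [hs k] using hT k _ _ ih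
  have hstable : ∀ k m, X ^ k ∣ s (k + m) - s k := by
    intro k m
    induction m with
    | zero => simp
    | succ m ih =>
      have := dvd_add ((pow_dvd_pow X (Nat.le_add_right k m)).trans (hstep (k + m))) ih
      rwa [sub_add_sub_cancel] at this
  let w : R⟦X⟧ := PowerSeries.mk fun i => coeff i (s (i + 1))
  have hw : ∀ k, X ^ k ∣ w - s k := by
    intro k
    rw [X_pow_dvd_iff]
    intro i hi
    obtain ⟨m, rfl⟩ := Nat.exists_eq_add_of_lt hi
    have := X_pow_dvd_iff.1 (hstable (i + 1) m) i (Nat.lt_succ_self i)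
    rw [map_sub, sub_eq_zero] at this ⊢
    rw [coeff_mk, ← this]
    congr 2
    ring
  refine ⟨w, ?_⟩
  ext i
  have := X_pow_dvd_iff.1 (dvd_sub (hw (i + 1)) (hs i ▸ hT i _ _ (hw i))) i (Nat.lt_succ_self i)
  rw [sub_sub_sub_cancel_right, map_sub, sub_eq_zero] at this
  exact this

/-- The pair `(Φ, w)` satisfies the equation of the metallic number `Φ = [n] + X ^ (2 n) w`, where
`w⁻¹ = (1 - X) (1 + X ^ n) + X Φ`. -/
structure MetallicPair (n : ℕ) (Φ w : R⟦X⟧) : Prop where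
  eq_add : Φ = qInt PowerSeries.X n + PowerSeries.X ^ (2 * n) * w
  mul_eq_one :
    w * ((1 - PowerSeries.X) * (1 + PowerSeries.X ^ n) + PowerSeries.X * Φ) = 1

theorem exists_metallicPair {n : ℕ} (hn : 1 ≤ n) : ∃ Φ w : R⟦X⟧, MetallicPair n Φ w := by
  obtain ⟨m, rfl⟩ := Nat.exists_eq_add_of_le' hn
  -- the coefficients come from `w⁻¹ = 1 - X (A + B w)`, after substituting for `Φ`
  obtain ⟨w, hw⟩ := exists_eq_one_add_X_mul (R := R)
    (1 - PowerSeries.X ^ m + PowerSeries.X ^ (m + 1) - qInt PowerSeries.X (m + 1))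
    (-PowerSeries.X ^ (2 * (m + 1)))
  exact ⟨_, w, rfl, by linear_combination hw⟩

theorem exists_mul_eq_one {D : R⟦X⟧} (hD : PowerSeries.coeff 0 D = 1) : ∃ y, y * D = 1 :=
  ⟨PowerSeries.invOfUnit D 1, PowerSeries.invOfUnit_mul D 1 (by simpa using hD)⟩

theorem neg_one_pow_mul_eq {x y : R} {a b : ℕ} (h : y = (-1) ^ b * x) (hab : Even (a + b)) :
    x = (-1) ^ a * y := by
  rw [h, ← mul_assoc, ← pow_add, hab.neg_one_pow, one_mul]

/-! ### Shifting the Hankel determinants of the metallic number -/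

open PowerSeries

namespace MetallicPair

variable {Φ w : R⟦X⟧}

/-- The case `ℓ = n` of the shift: a single step of size `n + 1`. -/
theorem hankelDet_last {n : ℕ} (hn : 1 ≤ n) (h : MetallicPair n Φ w) (j : ℕ) :
    hankelDet Φ n (n + 1 + j) = (-1) ^ (n * (n + 1) / 2 + j) * hankelDet Φ (n + 1) j := by
  obtain ⟨m, rfl⟩ := Nat.exists_eq_add_of_le' hn
  have e1 : Φ = qInt X (m + 1) + X ^ (m + 1) * (X ^ (m + 1) * w) := by rw [h.eq_add]; ring
  have e2 : Φ = qInt X (m + 1) + X ^ (m + 1 + 1) * (X ^ m * w) := by rw [h.eq_add]; ring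
  have s1 (j : ℕ) : hankelDet Φ (m + 1) j = hankelDet (X ^ (m + 1) * w) 0 j := by
    rw [e1, hankelDet_add_X_pow_mul]
    intro i hi
    rw [coeff_qInt_X, if_neg (by omega)]
  have s2 (j : ℕ) : hankelDet Φ (m + 1 + 1) j = hankelDet (X ^ m * w) 0 j := by
    rw [e2, hankelDet_add_X_pow_mul]
    intro i hi
    rw [coeff_qInt_X, if_neg (by omega)]
  rw [s1, s2]
  refine hankelDet_step (u := 1 + X * (qInt X (m + 1) - 1 + X ^ m - X ^ (m + 1))) ?_ ?_ ?_ j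
  · simp
  · intro i hi
    obtain ⟨i, rfl⟩ := Nat.exists_eq_add_of_le' (show 1 ≤ i by omega)
    rw [map_add, coeff_succ_X_mul, map_sub, map_add, map_sub, coeff_qInt_X, coeff_one, coeff_one,
      coeff_X_pow, coeff_X_pow]
    simp [show ¬ i < m + 1 by omega, show i ≠ 0 by omega, show i ≠ m by omega,
      show i ≠ m + 1 by omega]
  · have := h.mul_eq_one
    rw [e2] at this
    linear_combination X ^ (m + 1) * this

/-- The case `ℓ + 1 = n` of the shift: steps of sizes `1` and `n`. -/
theorem hankelDet_penultimate {ℓ : ℕ} (h : MetallicPair (ℓ + 1) Φ w) (j : ℕ) :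
    hankelDet Φ ℓ (1 + (ℓ + 1 + j)) =
      (-1) ^ (ℓ * (ℓ + 1) / 2 + j) * hankelDet Φ (ℓ + 1) j := by
  have e1 : Φ = qInt X ℓ + X ^ ℓ * (1 + X ^ (ℓ + 2) * w) := by
    rw [h.eq_add, qInt_add, qInt, qInt, Finset.sum_range_one]; ring
  have e2 : Φ = qInt X (ℓ + 1) + X ^ (ℓ + 1) * (X ^ (ℓ + 1) * w) := by rw [h.eq_add]; ring
  have s1 (j : ℕ) : hankelDet Φ ℓ j = hankelDet (1 + X ^ (ℓ + 2) * w) 0 j := by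
    rw [e1, hankelDet_add_X_pow_mul]
    intro i hi
    rw [coeff_qInt_X, if_neg (by omega)]
  have s2 (j : ℕ) : hankelDet Φ (ℓ + 1) j = hankelDet (X ^ (ℓ + 1) * w) 0 j := by
    rw [e2, hankelDet_add_X_pow_mul]
    intro i hi
    rw [coeff_qInt_X, if_neg (by omega)]
  obtain ⟨y, hy⟩ := exists_mul_eq_one
    (D := (1 - X) * (1 + X ^ (ℓ + 1)) + X * Φ + X ^ (ℓ + 2)) (by simp)
  have hw := h.mul_eq_one
  have step1 := hankelDet_step (F := 1 + X ^ (ℓ + 2) * w) (G := -(X ^ ℓ * y)) (u := 1) (d := 0)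
    (by simp) (fun i hi => by rw [coeff_one, if_neg (by omega)])
    (by
      -- `1 + X ^ (ℓ + 2) w = D' / (D' - X ^ (ℓ + 2))`, where `y = D'⁻¹`
      linear_combination (-X ^ (ℓ + 2) * w) * hy + X ^ (ℓ + 2) * y * hw) (ℓ + 1 + j)
  have step2 := hankelDet_step (F := X ^ ℓ * y) (G := X ^ (ℓ + 1) * w)
    (u := 1 + X * (qInt X (ℓ + 1) - 1 + X ^ ℓ)) (d := ℓ) (by simp)
    (by
      intro i hi
      obtain ⟨i, rfl⟩ := Nat.exists_eq_add_of_le' (show 1 ≤ i by omega)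
      rw [map_add, coeff_succ_X_mul, map_add, map_sub, coeff_qInt_X, coeff_one, coeff_one,
        coeff_X_pow]
      simp [show ¬ i < ℓ + 1 by omega, show i ≠ 0 by omega, show i ≠ ℓ by omega])
    (by
      rw [e2] at hy
      linear_combination X ^ ℓ * hy) j
  rw [hankelDet_neg, step2] at step1
  rw [s1, s2]
  simp only [zero_mul, Nat.zero_div, zero_add] at step1
  rw [step1, ← mul_assoc, ← pow_add, (Even.add_self _).neg_one_pow, one_mul]

/-- The case `ℓ + 2 ≤ n` of the shift: steps of sizes `1`, `n - ℓ - 1` and `ℓ + 1`. -/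
theorem hankelDet_of_add_two_le {ℓ k : ℕ} (h : MetallicPair (ℓ + (k + 2)) Φ w) (j : ℕ) :
    hankelDet Φ ℓ (1 + (k + 1 + (ℓ + 1 + j))) =
      (-1) ^ ((k + 1 + (ℓ + 1 + j)) + (k * (k + 1) / 2 + (ℓ + 1 + j)) +
        (ℓ * (ℓ + 1) / 2 + j)) * hankelDet Φ (ℓ + 1) j := by
  set n := ℓ + (k + 2) with hn
  set F := qInt (X : R⟦X⟧) (k + 2) + X ^ (n + k + 2) * w with hF
  set G := qInt (X : R⟦X⟧) (k + 1) + X ^ (n + k + 1) * w with hG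
  have e1 : Φ = qInt X ℓ + X ^ ℓ * F := by
    rw [h.eq_add, hn, qInt_add, hF]; ring
  have e2 : Φ = qInt X (ℓ + 1) + X ^ (ℓ + 1) * G := by
    rw [h.eq_add, hn, show ℓ + (k + 2) = (ℓ + 1) + (k + 1) by ring, qInt_add, hG]; ring
  have s1 (j : ℕ) : hankelDet Φ ℓ j = hankelDet F 0 j := by
    rw [e1, hankelDet_add_X_pow_mul]
    intro i hi
    rw [coeff_qInt_X, if_neg (by omega)]
  have s2 (j : ℕ) : hankelDet Φ (ℓ + 1) j = hankelDet G 0 j := by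
    rw [e2, hankelDet_add_X_pow_mul]
    intro i hi
    rw [coeff_qInt_X, if_neg (by omega)]
  obtain ⟨y, hy⟩ := exists_mul_eq_one (D := 1 + X * (X * qInt X ℓ) + X ^ (ℓ + 2) * G) (by simp)
  obtain ⟨z, hz⟩ := exists_mul_eq_one (D := qInt X (k + 2) + X ^ (k + 2) * (X ^ ℓ * y))
    (by rw [map_add, coeff_qInt_X, coeff_X_pow_mul', if_pos (by omega), if_neg (by omega),
      add_zero])
  have hw := h.mul_eq_one
  have hgeom := one_sub_mul_qInt (X : R⟦X⟧) (k + 2)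
  have hD : (1 - X) * (1 + X ^ n) + X * Φ =
      1 + X * (X * qInt X ℓ) + X ^ (ℓ + 2) * G + (1 - X) * X ^ n := by
    rw [e2, qInt_succ]; ring
  rw [hD] at hw
  have hFD : F * (1 + X * (X * qInt X ℓ) + X ^ (ℓ + 2) * G + (1 - X) * X ^ n) =
      qInt X (k + 2) * (1 + X * (X * qInt X ℓ) + X ^ (ℓ + 2) * G) + X ^ n := by
    generalize 1 + X * (X * qInt X ℓ) + X ^ (ℓ + 2) * G = E at *
    rw [hF]
    linear_combination X ^ n * hgeom + X ^ (n + k + 2) * hw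
  have step3 := hankelDet_step (F := X ^ ℓ * y) (G := G) (u := 1 + X * (X * qInt X ℓ)) (d := ℓ)
    (by simp)
    (by
      intro i hi
      obtain ⟨i, rfl⟩ := Nat.exists_eq_add_of_le' (show 2 ≤ i by omega)
      rw [map_add, coeff_succ_X_mul, coeff_succ_X_mul, coeff_qInt_X, coeff_one, if_neg (by omega),
        if_neg (by omega), add_zero])
    (by linear_combination X ^ ℓ * hy) j
  have step2 := hankelDet_step (F := X ^ k * z) (G := X ^ ℓ * y) (u := qInt X (k + 2)) (d := k)
    (by rw [coeff_qInt_X, if_pos (by omega)])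
    (fun i hi => by rw [coeff_qInt_X, if_neg (by omega)])
    (by linear_combination X ^ k * hz) (ℓ + 1 + j)
  have step1 := hankelDet_step (F := F) (G := X ^ k * z) (u := 1 - X) (d := 0)
    (by simp)
    (fun i hi => by
      rw [map_sub, coeff_one, coeff_X, if_neg (by omega), if_neg (by omega), sub_zero])
    (by
      have hnX : (X : R⟦X⟧) ^ n = X ^ ℓ * X ^ (k + 2) := by rw [hn, pow_add]
      generalize 1 + X * (X * qInt X ℓ) + X ^ (ℓ + 2) * G = E at *
      have hZ : (1 - X + X ^ (k + 2) * z) * (qInt X (k + 2) + X ^ n * y) =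
          y * (E + (1 - X) * X ^ n) := by
        rw [hnX]
        linear_combination hgeom + X ^ (k + 2) * hz - hy
      -- `F = Z E w` and `1 - X + X ^ (k + 2) z = y D / Z`, with `y E = w D = 1`
      linear_combination (-F * (1 - X + X ^ (k + 2) * z) + E * y) * hw +
        w * (1 - X + X ^ (k + 2) * z) * (hFD - X ^ n * hy) + w * E * hZ + hy)
    (k + 1 + (ℓ + 1 + j))
  rw [s1, s2, step1, step2, step3]
  simp only [zero_mul, Nat.zero_div, zero_add, pow_add]
  ring

/-- The exponents of the signs are exact halves, expressed by the triangular number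
`t = n (n - 1) / 2`. -/
theorem exists_sign_exponent {n : ℕ} (hn : 1 ≤ n) (ℓ : ℕ) :
    ∃ t, t + t + n = n * n ∧ n * (n - 1) / 2 = t ∧ n * (n + 2 * ℓ - 1) / 2 = t + n * ℓ := by
  obtain ⟨p, rfl⟩ := Nat.exists_eq_add_of_le' hn
  obtain ⟨t, ht⟩ := Nat.even_mul_succ_self p
  refine ⟨t, by linarith, ?_, ?_⟩
  · rw [Nat.add_sub_cancel, mul_comm]
    omega
  · rw [show p + 1 + 2 * ℓ - 1 = p + 2 * ℓ by omega]
    exact Nat.div_eq_of_eq_mul_left (by norm_num) (by linarith)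

/-- The Hankel determinants of the shifts `ℓ` and `ℓ + 1`. -/
theorem hankelDet_succ {n : ℕ} (hn : 1 ≤ n) (h : MetallicPair n Φ w) {ℓ : ℕ} (hℓ : ℓ ≤ n)
    (j : ℕ) :
    hankelDet Φ (ℓ + 1) j =
      (-1) ^ (j + n * (n + 2 * ℓ - 1) / 2) * hankelDet Φ ℓ (j + n + 1) := by
  obtain ⟨b, hb⟩ := Nat.even_mul_succ_self ℓ
  have hb' : ℓ * (ℓ + 1) / 2 = b := by omega
  obtain ⟨t, ht, -, hexp⟩ := exists_sign_exponent hn ℓ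
  rw [hexp]
  obtain ⟨k, rfl⟩ := Nat.exists_eq_add_of_le hℓ
  match k, h with
  | 0, h =>
    rw [add_zero] at *
    have := h.hankelDet_last hn j
    rw [hb'] at this
    refine neg_one_pow_mul_eq (b := b + j) ?_ ⟨j + b + t, by linarith⟩
    rw [← this]
    congr 1
    ring
  | 1, h =>
    have := h.hankelDet_penultimate j
    rw [hb'] at this
    refine neg_one_pow_mul_eq (b := b + j) ?_ ⟨j + 2 * b, by linarith⟩
    rw [← this]
    congr 1
    ring
  | k + 2, h =>
    obtain ⟨a, ha⟩ := Nat.even_mul_succ_self k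
    have ha' : k * (k + 1) / 2 = a := by omega
    have := h.hankelDet_of_add_two_le j
    rw [ha', hb'] at this
    refine neg_one_pow_mul_eq (b := (k + 1 + (ℓ + 1 + j)) + (a + (ℓ + 1 + j)) + (b + j)) ?_
      ⟨2 * j + 2 * b + k * ℓ + 2 * ℓ + a + k + 2, by linarith⟩
    rw [← this]
    congr 1
    ring

/-- The Hankel determinants of the shift `ℓ` in terms of the unshifted ones. -/
theorem hankelDet_eq_unshifted {n : ℕ} (hn : 1 ≤ n) (h : MetallicPair n Φ w) {ℓ : ℕ}
    (hℓ : ℓ ≤ n + 1) (j : ℕ) :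
    hankelDet Φ ℓ j = (-1) ^ (ℓ * j + ℓ * (ℓ - 1) / 2 + ℓ * (n * (n - 1) / 2)) *
      hankelDet Φ 0 (j + ℓ * (n + 1)) := by
  induction ℓ generalizing j with
  | zero => simp
  | succ ℓ ih =>
    obtain ⟨t, -, ht, hexp⟩ := exists_sign_exponent hn ℓ
    rw [h.hankelDet_succ hn (by omega), ih (by omega), hexp, ht, ← mul_assoc, ← pow_add,
      Nat.triangle_succ,
      show j + n + 1 + ℓ * (n + 1) = j + (ℓ + 1) * (n + 1) by ring,
      show j + (t + n * ℓ) + (ℓ * (j + n + 1) + ℓ * (ℓ - 1) / 2 + ℓ * t) =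
        (ℓ + 1) * j + (ℓ * (ℓ - 1) / 2 + ℓ) + (ℓ + 1) * t + (n * ℓ + n * ℓ) by ring,
      pow_add _ _ (n * ℓ + n * ℓ), (Even.add_self _).neg_one_pow, mul_one]

end MetallicPair

end Quadratic

/-! ### Convergence of the continued fraction -/

section Convergence

local notation "ι" => HahnSeries.ofPowerSeries ℤ ℚ

theorem q_ne_zero : q ≠ 0 := by
  simp [q]

theorem ofPowerSeries_X_eq_q : ι PowerSeries.X = q :=
  HahnSeries.ofPowerSeries_X

theorem tendsto_of_forall_exists_eq_q_pow_mul {c : ℕ → ℚ⸨X⸩} {L : ℚ⸨X⸩}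
    (h : ∀ k, ∃ m, k ≤ m ∧ ∃ p : ℚ⟦X⟧, c k - L = q ^ m * ι p) : Tendsto c atTop (𝓝 L) := by
  rw [tendsto_def]
  intro U hU
  obtain ⟨γ, hγ⟩ := Valued.mem_nhds.1 hU
  obtain ⟨N, hN⟩ := WithZero.exists_exp_neg_natCast_lt
    (x := MonoidWithZeroHom.ValueGroup₀.embedding γ.1) (by simp)
  filter_upwards [eventually_ge_atTop N] with k hk
  apply hγ
  rw [Set.mem_ofPred_eq, Valuation.restrict_lt_iff_lt_embedding]
  refine lt_of_le_of_lt ?_ hN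
  obtain ⟨m, hm, p, hp⟩ := h k
  rw [hp, map_mul, q, ← HahnSeries.ofPowerSeries_X, LaurentSeries.valuation_X_pow]
  have h1 : Valued.v (ι p) ≤ 1 := (LaurentSeries.val_le_one_iff_eq_coe ℚ _).2 ⟨p, rfl⟩
  refine (mul_le_of_le_one_right' h1).trans ?_
  rw [WithZero.exp_le_exp]
  omega

variable {n : ℕ}

theorem metallicFraction_get?_even (n k : ℕ) :
    (metallicFraction n).s.get? (2 * k) = some ⟨q ^ (n : ℤ), qInt q⁻¹ n⟩ := by
  exact congrArg some (if_pos (even_two_mul k))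

theorem metallicFraction_get?_odd (n k : ℕ) :
    (metallicFraction n).s.get? (2 * k + 1) = some ⟨q ^ (-(n : ℤ)), qInt q n⟩ := by
  exact congrArg some (if_neg (Nat.not_even_two_mul_add_one k))

theorem q_pow_mul_qInt_inv (n : ℕ) : q ^ n * qInt q⁻¹ n = q * qInt q n := by
  have hq := q_ne_zero
  induction n with
  | zero => simp [qInt]
  | succ n ih =>
    rw [qInt, Finset.sum_range_succ, ← qInt, qInt_succ, mul_add, pow_succ, mul_right_comm, ih,
      inv_pow]
    field_simp
    ring

/-- A sequence of numerators or of denominators of the continued fraction, multiplied by powers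
of `q` that turn the recurrence with coefficients in `ℚ((q))` into one with coefficients in
`ℚ[[q]]`. -/
theorem scaled_recurrence {u : ℕ → ℚ⸨X⸩}
    (hu : ∀ (m : ℕ) (gp : GenContFract.Pair ℚ⸨X⸩), (metallicFraction n).s.get? (m + 1) = some gp →
      u (m + 2) = gp.b * u (m + 1) + gp.a * u m) (k : ℕ) :
    q ^ (n * (k + 1)) * u (2 * (k + 1)) =
      qInt q n * (q ^ (n * (k + 1)) * u (2 * k + 1)) + q ^ (n * k) * u (2 * k) ∧
    q ^ (n * (k + 2)) * u (2 * (k + 1) + 1) =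
      q * qInt q n * (q ^ (n * (k + 1)) * u (2 * (k + 1))) +
        q ^ (2 * n) * (q ^ (n * (k + 1)) * u (2 * k + 1)) := by
  have hq := q_ne_zero
  have h1 := hu (2 * k) _ (metallicFraction_get?_odd n k)
  have h2 := hu (2 * k + 1) _ (metallicFraction_get?_even n (k + 1))
  simp only [zpow_neg, zpow_natCast] at h1 h2
  constructor
  · rw [show 2 * (k + 1) = 2 * k + 2 by ring, h1, mul_add, mul_add, pow_add, mul_one]
    field_simp
  · rw [show 2 * (k + 1) + 1 = 2 * k + 1 + 2 by ring, h2, ← q_pow_mul_qInt_inv,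
      show 2 * (k + 1) = 2 * k + 1 + 1 by ring]
    ring

/-- The scaled denominators are power series with constant term `1`, up to a factor `q` in the odd
ones; in particular no denominator vanishes. -/
theorem scaled_dens (hn : 1 ≤ n) (k : ℕ) : ∃ β γ : ℚ⟦X⟧,
    PowerSeries.coeff 0 β = 1 ∧ PowerSeries.coeff 0 γ = 1 ∧
    q ^ (n * k) * (metallicFraction n).dens (2 * k) = ι β ∧
    q ^ (n * (k + 1)) * (metallicFraction n).dens (2 * k + 1) = q * ι γ := by
  induction k with
  | zero =>
    refine ⟨1, qInt PowerSeries.X n, by simp, by rw [coeff_qInt_X, if_pos (by omega)], by simp, ?_⟩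
    rw [GenContFract.first_den_eq (metallicFraction_get?_even n 0), map_qInt, ofPowerSeries_X_eq_q,
      zero_add, mul_one, q_pow_mul_qInt_inv]
  | succ k ih =>
    obtain ⟨β, γ, hβ, hγ, h0, h1⟩ := ih
    obtain ⟨r0, r1⟩ := scaled_recurrence (n := n) (u := (metallicFraction n).dens)
      (fun m gp hgp => GenContFract.dens_recurrence hgp rfl rfl) k
    rw [h1, h0] at r0
    rw [h1, r0] at r1
    rw [r0, r1]
    refine ⟨PowerSeries.X * (qInt PowerSeries.X n * γ) + β,
      qInt PowerSeries.X n * (PowerSeries.X * (qInt PowerSeries.X n * γ) + β) +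
        PowerSeries.X ^ (2 * n) * γ, ?_, ?_, ?_, ?_⟩
    · rw [map_add, PowerSeries.coeff_zero_X_mul, hβ, zero_add]
    · rw [map_add, PowerSeries.coeff_X_pow_mul', if_neg (by omega), add_zero,
        PowerSeries.coeff_mul, Finset.Nat.antidiagonal_zero, Finset.sum_singleton, map_add,
        PowerSeries.coeff_zero_X_mul, hβ, coeff_qInt_X,
        if_pos (by omega), zero_add, mul_one]
    · simp only [map_add, map_mul, map_qInt, ofPowerSeries_X_eq_q]
      ring
    · simp only [map_add, map_mul, map_pow, map_qInt, ofPowerSeries_X_eq_q]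
      ring

/-- The error of the convergents, multiplied by their denominators: up to sign, it is the product
of the ratios of the partial numerators to the complete quotients, which are
`q ^ n / (q ^ (-n) / w)` and `q ^ (-n) / Φ` alternately. -/
theorem scaled_error {φ ω ψ : ℚ⸨X⸩} (h1 : φ = qInt q n + q ^ (2 * n) * ω)
    (h2 : q * qInt q n * ω + ψ * ω = 1) (h3 : ψ * φ = 1) (k : ℕ) :
    q ^ (n * k) * ((metallicFraction n).nums (2 * k) - φ * (metallicFraction n).dens (2 * k)) =
      -(q ^ (2 * n) * ω) ^ (k + 1) * ψ ^ k ∧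
    q ^ (n * (k + 1)) *
      ((metallicFraction n).nums (2 * k + 1) - φ * (metallicFraction n).dens (2 * k + 1)) =
      (q ^ (2 * n) * ω) ^ (k + 1) * ψ ^ (k + 1) := by
  induction k with
  | zero =>
    constructor
    · simp only [mul_zero, pow_zero, GenContFract.zeroth_num_eq_h, GenContFract.zeroth_den_eq_one]
      rw [h1, show (metallicFraction n).h = qInt q n from rfl]
      ring
    · rw [zero_add, mul_one, mul_zero, zero_add,
        GenContFract.first_num_eq (metallicFraction_get?_even n 0),
        GenContFract.first_den_eq (metallicFraction_get?_even n 0), zpow_natCast,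
        show (metallicFraction n).h = qInt q n from rfl]
      have := q_pow_mul_qInt_inv n
      linear_combination (qInt q n - φ) * this - q * qInt q n * h1 - q ^ (2 * n) * h2
  | succ k ih =>
    obtain ⟨r0, r1⟩ := scaled_recurrence (n := n)
      (u := fun m => (metallicFraction n).nums m - φ * (metallicFraction n).dens m)
      (fun m gp hgp => by
        rw [GenContFract.nums_recurrence hgp rfl rfl, GenContFract.dens_recurrence hgp rfl rfl]
        ring) k
    obtain ⟨i0, i1⟩ := ih
    rw [i0, i1] at r0
    rw [i1, r0] at r1
    rw [r0, r1]
    have e0 : qInt q n * ((q ^ (2 * n) * ω) ^ (k + 1) * ψ ^ (k + 1)) +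
        -(q ^ (2 * n) * ω) ^ (k + 1) * ψ ^ k =
        -(q ^ (2 * n) * ω) ^ (k + 1 + 1) * ψ ^ (k + 1) := by
      linear_combination (q ^ (2 * n) * ω) ^ (k + 1) * (-ψ ^ (k + 1) * h1 + ψ ^ k * h3)
    refine ⟨e0, ?_⟩
    rw [e0]
    linear_combination -q ^ (2 * n) * (q ^ (2 * n) * ω) ^ (k + 1) * ψ ^ (k + 1) * h2

theorem MetallicPair.map {R S : Type*} [CommRing R] [CommRing S] (f : R →+* S) {Φ w : R⟦X⟧}
    (h : MetallicPair n Φ w) : MetallicPair n (Φ.map f) (w.map f) where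
  eq_add := by
    have := congrArg (PowerSeries.map f) h.eq_add
    simpa only [map_add, map_mul, map_pow, PowerSeries.map_X, map_qInt] using this
  mul_eq_one := by
    have := congrArg (PowerSeries.map f) h.mul_eq_one
    simpa only [map_add, map_sub, map_one, map_mul, map_pow, PowerSeries.map_X] using this

theorem MetallicPair.tendsto_convs (hn : 1 ≤ n) {Φ w : ℚ⟦X⟧} (h : MetallicPair n Φ w) :
    Tendsto (fun k : ℕ => (metallicFraction n).convs k) atTop (𝓝 (ι Φ)) := by
  have hq := q_ne_zero
  obtain ⟨ψ, hψ⟩ := exists_mul_eq_one (D := Φ) (by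
    rw [h.eq_add, map_add, coeff_qInt_X, if_pos (by omega), PowerSeries.coeff_X_pow_mul',
      if_neg (by omega), add_zero])
  have h2 : PowerSeries.X * qInt PowerSeries.X n * w + ψ * w = 1 := by
    have hgeom := one_sub_mul_qInt (PowerSeries.X : ℚ⟦X⟧) n
    have hquad : Φ * ((1 - PowerSeries.X) * (1 + PowerSeries.X ^ n) + PowerSeries.X * Φ) =
        PowerSeries.X * qInt PowerSeries.X n * Φ + 1 := by
      linear_combination
        ((1 - PowerSeries.X) * (1 + PowerSeries.X ^ n) + PowerSeries.X * Φ) * h.eq_add +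
          (1 + PowerSeries.X ^ n) * hgeom + PowerSeries.X ^ (2 * n) * h.mul_eq_one
    have hΦ : PowerSeries.X * qInt PowerSeries.X n * w * Φ + w = Φ := by
      linear_combination -w * hquad + Φ * h.mul_eq_one
    linear_combination ψ * hΦ + (1 - PowerSeries.X * qInt PowerSeries.X n * w) * hψ
  have e1 := congrArg ι h.eq_add
  have e2 := congrArg ι h2
  have e3 := congrArg ι hψ
  simp only [map_add, map_mul, map_pow, map_one, map_qInt, ofPowerSeries_X_eq_q] at e1 e2 e3
  refine tendsto_of_forall_exists_eq_q_pow_mul fun m => ?_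
  obtain ⟨k, hk⟩ := Nat.even_or_odd' m
  obtain ⟨β, γ, hβ, hγ, hdβ, hdγ⟩ := scaled_dens hn k
  obtain ⟨hE0, hE1⟩ := scaled_error e1 e2 e3 k
  rcases hk with rfl | rfl
  · refine ⟨2 * n * (k + 1), by nlinarith, ?_⟩
    obtain ⟨y, hy⟩ := exists_mul_eq_one hβ
    have hy' := congrArg ι hy
    rw [map_mul, map_one, ← hdβ] at hy'
    have hd : (metallicFraction n).dens (2 * k) ≠ 0 := by
      rintro h0
      simp [h0] at hy'
    refine ⟨-(w ^ (k + 1) * ψ ^ k * y), ?_⟩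
    rw [GenContFract.conv_eq_num_div_den, div_sub' hd, div_eq_iff hd, mul_comm _ (ι Φ)]
    simp only [map_neg, map_mul, map_pow]
    refine mul_left_cancel₀ (pow_ne_zero (n * k) hq) ?_
    linear_combination hE0 + q ^ (2 * n * (k + 1)) * (ι w ^ (k + 1) * ι ψ ^ k) * hy'
  · obtain ⟨e, he⟩ := Nat.exists_eq_add_of_le' (show 1 ≤ 2 * n * (k + 1) by nlinarith)
    have he' : q ^ (2 * n * (k + 1)) = q ^ e * q := by rw [he, pow_succ]
    refine ⟨e, by nlinarith, ?_⟩
    obtain ⟨y, hy⟩ := exists_mul_eq_one hγ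
    have hy' := congrArg ι hy
    rw [map_mul, map_one] at hy'
    have hd : (metallicFraction n).dens (2 * k + 1) ≠ 0 := by
      rintro h0
      rw [h0, mul_zero, zero_eq_mul, or_iff_right hq] at hdγ
      simp [hdγ] at hy'
    refine ⟨w ^ (k + 1) * ψ ^ (k + 1) * y, ?_⟩
    rw [GenContFract.conv_eq_num_div_den, div_sub' hd, div_eq_iff hd, mul_comm _ (ι Φ)]
    simp only [map_mul, map_pow]
    refine mul_left_cancel₀ (pow_ne_zero (n * (k + 1)) hq) ?_
    linear_combination hE1 + ι w ^ (k + 1) * ι ψ ^ (k + 1) * he' -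
      q ^ e * q * (ι w ^ (k + 1) * ι ψ ^ (k + 1)) * hy' -
      q ^ e * (ι w ^ (k + 1) * ι ψ ^ (k + 1) * ι y) * hdγ

end Convergence

end QMetallic

theorem mainTheorem4 (n : ℕ) (hn : 1 ≤ n) :
    (∃! Φ : ℤ⟦X⟧, QMetallic.IsQMetallic n Φ) ∧
    ∀ Φ : ℤ⟦X⟧, QMetallic.IsQMetallic n Φ →
      (∀ ℓ : ℕ, ℓ ≤ n → ∀ j : ℕ,
        QMetallic.hankelDet Φ (ℓ + 1) j =
          (-1) ^ (j + n * (n + 2 * ℓ - 1) / 2) * QMetallic.hankelDet Φ ℓ (j + n + 1)) ∧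
      (∀ ℓ : ℕ, ℓ ≤ n + 1 → ∀ j : ℕ,
        QMetallic.hankelDet Φ ℓ j =
          (-1) ^ (ℓ * j + ℓ * (ℓ - 1) / 2 + ℓ * (n * (n - 1) / 2)) *
            QMetallic.hankelDet Φ 0 (j + ℓ * (n + 1))) := by
  obtain ⟨Φ, w, h⟩ := QMetallic.exists_metallicPair (R := ℤ) hn
  have hΦ : QMetallic.IsQMetallic n Φ := (h.map (Int.castRingHom ℚ)).tendsto_convs hn
  have huniq : ∀ Ψ, QMetallic.IsQMetallic n Ψ → Ψ = Φ := fun Ψ hΨ =>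
    PowerSeries.map_injective _ Int.cast_injective
      (HahnSeries.ofPowerSeries_injective (tendsto_nhds_unique hΨ hΦ))
  refine ⟨⟨Φ, hΦ, huniq⟩, ?_⟩
  intro Ψ hΨ
  rw [huniq Ψ hΨ]
  exact ⟨fun ℓ hℓ j => h.hankelDet_succ hn hℓ j, fun ℓ hℓ j => h.hankelDet_eq_unshifted hn hℓ j⟩
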